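/- For $\beta\in\mathbb{R}\setminus\{0,-1,-2,\dots\}$ let $f_\beta$ denote the distribution on $\mathbb{R}$ obtained as follows. For $\beta>0$ it is the locally integrable function equal to $t^{\beta-1}$ for $t>0$ and to $0$ for $t<0$; for the other $\beta$ it is defined recursively by $f_\beta=\frac1\beta\,\frac{d}{dt}f_{\beta+1}$, with the derivative of distributions. The convolution $u*v$ of two distributions supported in $[0,\infty)$ is the distribution $\langle u*v,\varphi\rangle=\langle u(x),\langle v(y),\varphi(x+y)\rangle\rangle$ (with smooth cutoffs $\eta(x)$, $\eta(y)$ inserted that equal $1$ near $[0,\infty)$ and vanish near $-\infty$; the result does not depend on $\eta$). Let $\delta$ be the Dirac distribution at $0$. Let $\alpha\in\mathbb{R}\setminus\mathbb{Z}$. Then the following holds. (i) The $f_\beta$ are the analytic continuation of $t_+^{\beta-1}$ in $\beta$: for every test function $\varphi$ there is an analytic function $F$ on $\mathbb{C}\setminus\{0,-1,-2,\dots\}$ such that $F(s)=\int_0^\infty t^{s-1}\varphi(t)\,dt$ (absolutely convergent) for $\operatorname{Re}s>0$ and $F(\beta)=\langle f_\beta,\varphi\rangle$ for all real $\beta\notin\{0,-1,-2,\dots\}$.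 (ii) The distributions $f_\alpha$ and $f_{-\alpha}$ are supported in $[0,\infty)$, their convolution exists, and $$f_\alpha*f_{-\alpha}=-\frac{\pi}{\alpha\sin(\pi\alpha)}\,\delta .$$ (iii) In terms of the convolution integral, $$\int_0^t\tau^{\alpha-1}(t-\tau)^{-\alpha-1}\,d\tau=-\frac{\pi}{\alpha\sin(\pi\alpha)}\,\delta(t)$$ in the sense of analytic continuation in the exponents: for every test function $\varphi$ there is an analytic function $G$ of $(a,b)\in(\mathbb{C}\setminus\{0,-1,-2,\dots\})^2$ such that, for $\operatorname{Re}a>0$ and $\operatorname{Re}b>0$, $$G(a,b)=\int_0^\infty\Big(\int_0^t\tau^{a-1}(t-\tau)^{b-1}\,d\tau\Big)\varphi(t)\,dt$$ with absolutely convergent integrals, and $$G(\alpha,-\alpha)=-\frac{\pi}{\alpha\sin(\pi\alpha)}\,\varphi(0).$$ -/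

import Mathlib

open scoped Distributions ContDiff
open MeasureTheory

/-- Real distributions on the real line. -/
abbrev RealDistribution : Type := 𝓓'((⊤ : TopologicalSpace.Opens ℝ), ℝ)

/-- Real test functions on the real line: smooth functions with compact support. -/
abbrev RealTestFunction : Type := 𝓓((⊤ : TopologicalSpace.Opens ℝ), ℝ)

/-- The regular distribution `φ ↦ ∫ φ(t) g(t) dt` of a locally integrable function `g`. -/
noncomputable def regularDistribution (g : ℝ → ℝ) : RealDistribution :=
  TestFunction.integralAgainstBilinCLM (ContinuousLinearMap.mul ℝ ℝ) volume g

/-- The function `f_α`, equal to `t ^ (α - 1)` for `t > 0` and to `0` for `t ≤ 0`. -/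
noncomputable def powFun (α : ℝ) (t : ℝ) : ℝ :=
  if 0 < t then t ^ (α - 1) else 0

/-- The `n`-th step of the downward extension in `α` by the rule `f_α = α⁻¹ (f_{α+1})'`, with the
derivative taken in the sense of distributions:
`powDistributionAux n α = (α (α + 1) ⋯ (α + n - 1))⁻¹ (d/dt)^n f_{α+n}`. -/
noncomputable def powDistributionAux : ℕ → ℝ → RealDistribution
  | 0, α => regularDistribution (powFun α)
  | n + 1, α => α⁻¹ • Distribution.lineDerivCLM (1 : ℝ) (powDistributionAux n (α + 1))

/-- The distribution `f_α` (usually written `t₊^(α-1)`), for every real `α` other than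
`0, -1, -2, …`. The number `n = ⌊1 - α⌋₊` is `0` for `α > 0`, where `f_α` is the regular
distribution of `powFun α`, and in general it is the least `n` such that `α + n > 0`. -/
noncomputable def powDistribution (α : ℝ) : RealDistribution :=
  powDistributionAux ⌊1 - α⌋₊ α

/-- A smooth function that is `1` on a neighbourhood of `[0, ∞)` and vanishes near `-∞`. -/
structure HalfLineCutoff where
  toFun : ℝ → ℝ
  smooth : ContDiff ℝ ∞ toFun
  eq_zero : ∃ a : ℝ, ∀ x ≤ a, toFun x = 0
  eq_one : ∃ ε > 0, ∀ x ≥ -ε, toFun x = 1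

/-- The test function `y ↦ η(y) φ(x + y)`. -/
noncomputable def cutTranslate (η : HalfLineCutoff) (φ : RealTestFunction) (x : ℝ) : RealTestFunction where
  toFun y := η.toFun y * φ (x + y)
  contDiff' := η.smooth.mul (φ.contDiff.comp (contDiff_const.add contDiff_id))
  hasCompactSupport' :=
    (φ.hasCompactSupport.comp_homeomorph (Homeomorph.addLeft x)).mul_left
  tsupport_subset' := by simp

/-- `IsConvolution u v w`: the distributions `u` and `v` are supported in `[0, ∞)`, their
convolution exists, and it is equal to `w`. That is,
`⟨w, φ⟩ = ⟨u(x), ⟨v(y), φ(x + y)⟩⟩` for every test function `φ`, where cutoffs `η(x)`, `η(y)`, which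
do not change anything on the supports of `u` and `v`, make the functions that `u` and `v` are
applied to test functions; the existence of the test function `ψ(x) = η(x) ⟨v(y), η(y) φ(x + y)⟩`
and the independence of `η` are part of the claim. -/
def IsConvolution (u v w : RealDistribution) : Prop :=
  Distribution.IsVanishingOn u (Set.Iio 0) ∧ Distribution.IsVanishingOn v (Set.Iio 0) ∧
    ∀ (η : HalfLineCutoff) (φ : RealTestFunction), ∃ ψ : RealTestFunction,
      (∀ x, ψ x = η.toFun x * v (cutTranslate η φ x)) ∧ w φ = u ψ

/-- There are cutoffs. -/
noncomputable def HalfLineCutoff.std : HalfLineCutoff where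
  toFun x := Real.smoothTransition (x + 2)
  smooth := Real.smoothTransition.contDiff.comp (contDiff_id.add contDiff_const)
  eq_zero := ⟨-2, fun x hx => Real.smoothTransition.zero_of_nonpos (by linarith)⟩
  eq_one := ⟨1, one_pos, fun x hx => Real.smoothTransition.one_of_one_le (by linarith)⟩

/-- The convolution is unique. -/
theorem IsConvolution.unique {u v w w' : RealDistribution}
    (h : IsConvolution u v w) (h' : IsConvolution u v w') : w = w' := by
  ext φ
  obtain ⟨ψ, hψ, e⟩ := h.2.2 HalfLineCutoff.std φ
  obtain ⟨ψ', hψ', e'⟩ := h'.2.2 HalfLineCutoff.std φ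
  have : ψ = ψ' := TestFunction.ext fun x => (hψ x).trans (hψ' x).symm
  rw [e, e', this]

open Set Filter Topology

/-! Let `M g s = ∫_0^∞ t^(s-1) g(t) dt` be the Mellin transform. Integration by parts gives `s * M g
s = -M g' (s+1)`, so `E g s = M g s / Γ(s)` satisfies `E g s = -E g' (s+1)`. Iterating this extends
`E g` to an entire function (`regularizedMellin_eq`, `differentiable_entireMellin`), and `E g 0 =
-∫_0^∞ g' = g 0` (`entireMellin_zero`): this is the source of the delta.

The recursion for `f_β` is the same integration by parts, so `⟨f_β, φ⟩ = Γ(β) E φ β`, which is (i).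
For (iii), the inner integral is `B(a,b) t^(a+b-1)`, hence `G(a,b) = Γ(a) Γ(b) E φ (a+b)`. At `(α,
-α)` this is `Γ(α) Γ(-α) φ(0)`, evaluated by the reflection formula.

For (ii), choose `m`, `n` with `α + m > 0` and `-α + n > 0` and move all derivatives onto `φ`. The
iterated pairing becomes an absolutely convergent double integral, which Fubini and the Beta
integral reduce to a moment of `φ^(m+n)` (`integral_mul_translatedMoment`). That moment is `φ(0)` up
to sign and `Γ(m+n)` (`moment_iteratedDeriv`). -/

/-! ### Mellin transforms of compactly supported functions. -/

theorem HasCompactSupport.exists_forall_gt_eq_zero {E : Type*} [Zero E] {g : ℝ → E}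
    (hc : HasCompactSupport g) : ∃ R : ℝ, ∀ t, R < t → g t = 0 := by
  obtain ⟨R, hR⟩ := hc.isCompact.bddAbove
  exact ⟨R, fun t ht => image_eq_zero_of_notMem_tsupport fun h => (hR h).not_gt ht⟩

theorem HasCompactSupport.eventuallyEq_atTop {E : Type*} [Zero E] {g : ℝ → E}
    (hc : HasCompactSupport g) : g =ᶠ[atTop] fun _ => 0 := by
  obtain ⟨R, hR⟩ := hc.exists_forall_gt_eq_zero
  filter_upwards [eventually_gt_atTop R] with t ht using hR t ht

theorem isBigO_nhdsGT_zero_of_continuous {g : ℝ → ℂ} (hg : Continuous g) :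
    g =O[𝓝[>] 0] fun t : ℝ => t ^ (-(0 : ℝ)) := by
  simp only [neg_zero, Real.rpow_zero]
  exact (hg.tendsto 0).isBigO_one ℝ |>.mono nhdsWithin_le_nhds

theorem mellinConvergent_of_hasCompactSupport {g : ℝ → ℂ} (hg : Continuous g)
    (hc : HasCompactSupport g) {s : ℂ} (hs : 0 < s.re) : MellinConvergent g s :=
  mellinConvergent_of_isBigO_rpow (hg.locallyIntegrable.locallyIntegrableOn _)
    (hc.eventuallyEq_atTop.trans_isBigO (Asymptotics.isBigO_zero _ _)) (lt_add_one s.re)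
    (isBigO_nhdsGT_zero_of_continuous hg) hs

theorem differentiableAt_mellin_of_hasCompactSupport {g : ℝ → ℂ} (hg : Continuous g)
    (hc : HasCompactSupport g) {s : ℂ} (hs : 0 < s.re) : DifferentiableAt ℂ (mellin g) s :=
  mellin_differentiableAt_of_isBigO_rpow (hg.locallyIntegrable.locallyIntegrableOn _)
    (hc.eventuallyEq_atTop.trans_isBigO (Asymptotics.isBigO_zero _ _)) (lt_add_one s.re)
    (isBigO_nhdsGT_zero_of_continuous hg) hs

theorem HasCompactSupport.comp_ofReal {g : ℝ → ℝ} (hc : HasCompactSupport g) :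
    HasCompactSupport fun t => (g t : ℂ) :=
  hc.comp_left Complex.ofReal_zero

/-- Integration by parts for the Mellin transform. -/
theorem mul_mellin_eq_neg_mellin_deriv {g : ℝ → ℝ} (hg : ContDiff ℝ 1 g)
    (hc : HasCompactSupport g) {s : ℂ} (hs : 0 < s.re) :
    s * mellin (fun t => (g t : ℂ)) s = -mellin (fun t => ((deriv g t : ℝ) : ℂ)) (s + 1) := by
  have hs0 : s ≠ 0 := by rintro rfl; simp at hs
  have hg' : Continuous fun t => (g t : ℂ) := Complex.continuous_ofReal.comp hg.continuous
  have hd : Continuous fun t => ((deriv g t : ℝ) : ℂ) :=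
    Complex.continuous_ofReal.comp (hg.continuous_deriv le_rfl)
  have c0 := mellinConvergent_of_hasCompactSupport hg' hc.comp_ofReal hs
  have c1 := mellinConvergent_of_hasCompactSupport hd hc.deriv.comp_ofReal
    (s := s + 1) (by simp; linarith)
  have hcont : Continuous fun t : ℝ => (t : ℂ) ^ s := Complex.continuous_ofReal_cpow_const hs
  -- Both boundary terms vanish: `t^s → 0` at `0` because `Re s > 0`, and `g` is zero for large `t`.
  have key := integral_Ioi_mul_deriv_eq_deriv_mul (a := (0 : ℝ)) (a' := (0 : ℂ)) (b' := (0 : ℂ))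
    (u := fun t : ℝ => (t : ℂ) ^ s) (u' := fun t : ℝ => s * (t : ℂ) ^ (s - 1))
    (v := fun t => (g t : ℂ)) (v' := fun t => ((deriv g t : ℝ) : ℂ))
    (fun x hx => hasDerivAt_ofReal_cpow_const (ne_of_gt hx) hs0)
    (fun x _ => (hg.differentiable one_ne_zero x).hasDerivAt.ofReal_comp)
    (by simpa [MellinConvergent, Pi.mul_def] using c1)
    (by
      have := c0.const_smul s
      rw [MellinConvergent] at this
      refine this.congr_fun (fun t _ => ?_) measurableSet_Ioi
      simp only [Pi.mul_apply, smul_eq_mul]; ring)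
    (by
      have := ((hcont.mul hg').tendsto 0).mono_left (nhdsWithin_le_nhds (s := Ioi (0 : ℝ)))
      simpa [Complex.zero_cpow hs0, Pi.mul_def] using this)
    (by
      refine tendsto_const_nhds.congr' ?_
      filter_upwards [hc.comp_ofReal.eventuallyEq_atTop] with t ht
      simp [Pi.mul_apply, ht])
  simp only [mellin, add_sub_cancel_right, smul_eq_mul]
  rw [key, ← integral_const_mul]
  simp only [sub_self, zero_sub, neg_neg]
  refine integral_congr_ae (Eventually.of_forall fun t => ?_)
  simp only []; ring

/-! ### The entire quotient of the Mellin transform by Gamma. -/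

theorem continuous_iteratedDeriv {g : ℝ → ℝ} (hg : ContDiff ℝ ∞ g) (n : ℕ) :
    Continuous (iteratedDeriv n g) :=
  hg.continuous_iteratedDeriv n (by exact_mod_cast le_top)

theorem contDiff_iteratedDeriv {g : ℝ → ℝ} (hg : ContDiff ℝ ∞ g) (n : ℕ) :
    ContDiff ℝ ∞ (iteratedDeriv n g) := by
  induction n with
  | zero => simpa using hg
  | succ n ih =>
    rw [iteratedDeriv_succ]
    exact (contDiff_infty_iff_deriv.1 ih).2

theorem HasCompactSupport.iteratedDeriv {g : ℝ → ℝ} (hc : HasCompactSupport g) (n : ℕ) :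
    HasCompactSupport (iteratedDeriv n g) := by
  induction n with
  | zero => simpa using hc
  | succ n ih =>
    rw [iteratedDeriv_succ]
    exact ih.deriv

/-- The Mellin transform divided by the Gamma function, after `n` integrations by parts. -/
noncomputable def regularizedMellin (n : ℕ) (g : ℝ → ℝ) (s : ℂ) : ℂ :=
  (-1) ^ n * (mellin (fun t => ((iteratedDeriv n g t : ℝ) : ℂ)) (s + n) * (Complex.Gamma (s + n))⁻¹)

/-- The factor `s + n` from integration by parts cancels against `Γ(s+n+1) = (s+n) Γ(s+n)`. -/
theorem regularizedMellin_succ {g : ℝ → ℝ} (hg : ContDiff ℝ ∞ g) (hc : HasCompactSupport g)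
    (n : ℕ) {s : ℂ} (hs : 0 < s.re + n) :
    regularizedMellin (n + 1) g s = regularizedMellin n g s := by
  have hs' : 0 < (s + n).re := by simpa using hs
  have h0 : s + n ≠ 0 := by intro h; simp [h] at hs'
  have key := mul_mellin_eq_neg_mellin_deriv ((contDiff_iteratedDeriv hg n).of_le (by simp))
    (hc.iteratedDeriv n) hs'
  have hG := Complex.Gamma_ne_zero_of_re_pos hs'
  rw [regularizedMellin, regularizedMellin, iteratedDeriv_succ]
  push_cast
  rw [← add_assoc, Complex.Gamma_add_one _ h0]
  have : mellin (fun t => ((deriv (iteratedDeriv n g) t : ℝ) : ℂ)) (s + n + 1) =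
    -((s + n) * mellin (fun t => ((iteratedDeriv n g t : ℝ) : ℂ)) (s + n)) := by rw [key, neg_neg]
  rw [this, pow_succ]
  field_simp

theorem regularizedMellin_eq {g : ℝ → ℝ} (hg : ContDiff ℝ ∞ g) (hc : HasCompactSupport g)
    {m n : ℕ} {s : ℂ} (hm : 0 < s.re + m) (hn : 0 < s.re + n) :
    regularizedMellin m g s = regularizedMellin n g s := by
  wlog h : n ≤ m generalizing m n
  · exact (this hn hm (le_of_not_ge h)).symm
  induction m, h using Nat.le_induction with
  | base => rfl
  | succ m h ih =>
    have : 0 < s.re + m := hn.trans_le (by gcongr)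
    rw [regularizedMellin_succ hg hc m this, ih this]

/-- The entire function `s ↦ mellin g s / Γ(s)`. -/
noncomputable def entireMellin (g : ℝ → ℝ) (s : ℂ) : ℂ := regularizedMellin (⌊-s.re⌋₊ + 1) g s

theorem entireMellin_eq {g : ℝ → ℝ} (hg : ContDiff ℝ ∞ g) (hc : HasCompactSupport g)
    {n : ℕ} {s : ℂ} (hn : 0 < s.re + n) : entireMellin g s = regularizedMellin n g s := by
  refine regularizedMellin_eq hg hc ?_ hn
  have := Nat.lt_floor_add_one (-s.re)
  push_cast
  linarith

/-- Although `n` depends on `s` in the definition, one fixed `n` serves a whole neighbourhood of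
`s`; there the Mellin factor is holomorphic, and `1/Γ` is entire. -/
theorem differentiable_entireMellin {g : ℝ → ℝ} (hg : ContDiff ℝ ∞ g)
    (hc : HasCompactSupport g) : Differentiable ℂ (entireMellin g) := by
  intro s
  obtain ⟨n, hn⟩ := exists_nat_gt (-s.re)
  have hn' : 0 < s.re + n := by linarith
  have ev : entireMellin g =ᶠ[𝓝 s] regularizedMellin n g := by
    have : ∀ᶠ z : ℂ in 𝓝 s, 0 < z.re + n :=
      (Complex.continuous_re.add continuous_const).continuousAt.eventually_const_lt hn'
    filter_upwards [this] with z hz using entireMellin_eq hg hc hz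
  refine DifferentiableAt.congr_of_eventuallyEq ?_ ev
  refine DifferentiableAt.const_mul (DifferentiableAt.mul ?_ ?_) _
  · exact (differentiableAt_mellin_of_hasCompactSupport
      (Complex.continuous_ofReal.comp (continuous_iteratedDeriv hg n))
      (hc.iteratedDeriv n).comp_ofReal (by simpa using hn')).comp s
        (differentiableAt_id.add_const (n : ℂ))
  · exact (Complex.differentiable_one_div_Gamma _).comp s (differentiableAt_id.add_const (n : ℂ))

theorem entireMellin_of_re_pos {g : ℝ → ℝ} (hg : ContDiff ℝ ∞ g) (hc : HasCompactSupport g)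
    {s : ℂ} (hs : 0 < s.re) :
    Complex.Gamma s * entireMellin g s = mellin (fun t => (g t : ℂ)) s := by
  rw [entireMellin_eq (n := 0) hg hc (by simpa using hs), regularizedMellin]
  have hG := Complex.Gamma_ne_zero_of_re_pos hs
  simp only [pow_zero, iteratedDeriv_zero, Nat.cast_zero, add_zero, one_mul]
  field_simp

theorem entireMellin_zero {g : ℝ → ℝ} (hg : ContDiff ℝ ∞ g) (hc : HasCompactSupport g) :
    entireMellin g 0 = g 0 := by
  rw [entireMellin_eq (n := 1) hg hc (by simp), regularizedMellin]
  have h := integral_Ioi_of_hasDerivAt_of_tendsto' (a := (0 : ℝ)) (m := (0 : ℝ)) (f := g)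
    (f' := deriv g)
    (fun x _ => (hg.differentiable (by simp) x).hasDerivAt)
    (((hg.continuous_deriv (by simp)).integrable_of_hasCompactSupport hc.deriv).integrableOn)
    (tendsto_const_nhds.congr' hc.eventuallyEq_atTop.symm)
  have h2 : mellin (fun t => ((deriv g t : ℝ) : ℂ)) 1 = ((0 - g 0 : ℝ) : ℂ) := by
    rw [← h, ← integral_complex_ofReal]
    simp [mellin]
  simp only [iteratedDeriv_one, Nat.cast_one, zero_add, h2, Complex.Gamma_one]
  simp

theorem analyticAt_Gamma {s : ℂ} (hs : ∀ n : ℕ, s ≠ -(n : ℂ)) :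
    AnalyticAt ℂ Complex.Gamma s := by
  have h := (Complex.differentiable_one_div_Gamma.analyticAt s).inv
    (inv_ne_zero (Complex.Gamma_ne_zero hs))
  exact h.congr (Eventually.of_forall fun z => by simp)

/-! ### The distributions `f_β` as values of the continued Mellin transform. -/

/-- The Mellin transform at a real point is the cast of the real integral. -/
theorem mellin_ofReal (g : ℝ → ℝ) (s : ℝ) :
    mellin (fun t => (g t : ℂ)) s = ((∫ t in Ioi (0 : ℝ), t ^ (s - 1) * g t : ℝ) : ℂ) := by
  rw [← integral_complex_ofReal]
  refine setIntegral_congr_fun measurableSet_Ioi fun t ht => ?_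
  simp [Complex.ofReal_cpow (le_of_lt ht)]

theorem integrableOn_rpow_mul {g : ℝ → ℝ} (hg : Continuous g) (hc : HasCompactSupport g)
    {s : ℝ} (hs : 0 < s) : IntegrableOn (fun t => t ^ (s - 1) * g t) (Ioi 0) := by
  have h := mellinConvergent_of_hasCompactSupport (Complex.continuous_ofReal.comp hg)
    hc.comp_ofReal (s := s) (by simpa using hs)
  have h2 := h.re
  refine IntegrableOn.congr_fun h2 (fun t ht => ?_) measurableSet_Ioi
  simp only [Function.comp_apply, smul_eq_mul]
  rw [← Complex.ofReal_one, ← Complex.ofReal_sub, ← Complex.ofReal_cpow (le_of_lt ht),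
    ← Complex.ofReal_mul]
  rfl

theorem regularizedMellin_ofReal (n : ℕ) (g : ℝ → ℝ) (s : ℝ) :
    regularizedMellin n g s =
      (((-1) ^ n * ((∫ t in Ioi (0 : ℝ), t ^ (s + n - 1) * iteratedDeriv n g t) *
        (Real.Gamma (s + n))⁻¹) : ℝ) : ℂ) := by
  rw [regularizedMellin, ← Complex.ofReal_natCast, ← Complex.ofReal_add, mellin_ofReal,
    Complex.Gamma_ofReal]
  push_cast
  rfl

theorem locallyIntegrable_powFun {β : ℝ} (hβ : 0 < β) : LocallyIntegrable (powFun β) := by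
  have h : ∀ R : ℝ, IntegrableOn (powFun β) (Iic R) := by
    intro R
    have h1 : IntegrableOn (powFun β) (Ioc 0 (max R 0)) := by
      have h2 := (intervalIntegral.intervalIntegrable_rpow' (a := 0) (b := max R 0)
        (r := β - 1) (by linarith)).1
      exact h2.congr_fun (fun t ht => by simp [powFun, ht.1]) measurableSet_Ioc
    have h0 : IntegrableOn (powFun β) (Iic 0) :=
      (integrableOn_zero (ε' := ℝ)).congr_fun
        (fun t ht => by simp [powFun, not_lt.2 (mem_Iic.1 ht)]) measurableSet_Iic
    refine (h0.union h1).mono_set fun t ht => ?_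
    rcases le_or_gt t 0 with h | h
    · exact Or.inl h
    · exact Or.inr ⟨h, (mem_Iic.1 ht).trans (le_max_left _ _)⟩
  intro x
  exact ⟨Iic (x + 1), Iic_mem_nhds (by linarith), h _⟩

theorem integral_powFun_mul (β : ℝ) (g : ℝ → ℝ) :
    ∫ t, powFun β t * g t = ∫ t in Ioi (0 : ℝ), t ^ (β - 1) * g t := by
  rw [← integral_indicator measurableSet_Ioi]
  congr 1
  ext t
  by_cases h : 0 < t <;> simp [powFun, h]

/-- The derivative of a test function. -/
noncomputable def RealTestFunction.derivative (φ : RealTestFunction) : RealTestFunction :=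
  TestFunction.lineDerivCLM ℝ (1 : ℝ) φ

theorem RealTestFunction.coe_derivative (φ : RealTestFunction) :
    ⇑φ.derivative = deriv φ := by
  ext x
  rw [RealTestFunction.derivative, TestFunction.lineDerivCLM_apply_of_le (by simp)]
  simp [lineDeriv, deriv_comp_const_add (f := φ) (a := x) (x := 0)]

/-- The quotient `Γ(β) / Γ(β+n)` is the product of the factors `(β+k)⁻¹` of the recursion, and each
distributional derivative contributes a sign. -/
theorem powDistributionAux_apply (n : ℕ) {β : ℝ} (h0 : ∀ k : ℕ, β ≠ -(k : ℝ))
    (hn : 0 < β + n) (φ : RealTestFunction) :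
    powDistributionAux n β φ = (-1) ^ n * (Real.Gamma β * (Real.Gamma (β + n))⁻¹) *
      ∫ t in Ioi (0 : ℝ), t ^ (β + n - 1) * iteratedDeriv n φ t := by
  induction n generalizing β φ with
  | zero =>
    simp only [Nat.cast_zero, add_zero] at hn
    have hG := (Real.Gamma_pos_of_pos hn).ne'
    have h : powDistributionAux 0 β φ = ∫ t, φ t * powFun β t :=
      TestFunction.integralAgainstBilinCLM_eq_integral
        ((locallyIntegrable_powFun hn).locallyIntegrableOn _)
    simp only [h, pow_zero, Nat.cast_zero, add_zero, iteratedDeriv_zero, one_mul]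
    rw [mul_inv_cancel₀ hG, one_mul, ← integral_powFun_mul]
    simp only [mul_comm]
  | succ n ih =>
    have hβ : β ≠ 0 := by simpa using h0 0
    have key := ih (β := β + 1) (fun k h => h0 (k + 1) (by push_cast; linarith))
      (by push_cast at hn; linarith) φ.derivative
    change β⁻¹ * (-(powDistributionAux n (β + 1) φ.derivative)) = _
    rw [key, φ.coe_derivative, Real.Gamma_add_one hβ, iteratedDeriv_succ']
    have e : β + 1 + (n : ℝ) = β + ((n + 1 : ℕ) : ℝ) := by push_cast; ring
    rw [e]
    field_simp
    ring

theorem add_floor_pos (β : ℝ) (h0 : ∀ k : ℕ, β ≠ -(k : ℝ)) : 0 < β + ⌊1 - β⌋₊ := by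
  rcases lt_or_ge (1 - β) 0 with h | h
  · have : (0 : ℝ) ≤ ⌊1 - β⌋₊ := Nat.cast_nonneg _
    linarith
  · have h1 := Nat.lt_floor_add_one (1 - β)
    refine lt_of_le_of_ne (by linarith) fun h => h0 ⌊1 - β⌋₊ (by linarith)

theorem powDistribution_apply {β : ℝ} (h0 : ∀ k : ℕ, β ≠ -(k : ℝ)) (φ : RealTestFunction) :
    ((powDistribution β φ : ℝ) : ℂ) = Complex.Gamma β * entireMellin φ β := by
  have hn := add_floor_pos β h0
  rw [powDistribution, powDistributionAux_apply _ h0 hn,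
    entireMellin_eq φ.contDiff φ.hasCompactSupport (n := ⌊1 - β⌋₊) (by simpa using hn),
    regularizedMellin_ofReal, Complex.Gamma_ofReal]
  push_cast
  ring

theorem isVanishingOn_powDistribution {β : ℝ} (h0 : ∀ k : ℕ, β ≠ -(k : ℝ)) :
    Distribution.IsVanishingOn (powDistribution β) (Iio 0) := by
  intro φ hφ
  rw [powDistribution, powDistributionAux_apply _ h0 (add_floor_pos β h0)]
  refine mul_eq_zero_of_right _ ?_
  rw [setIntegral_congr_fun (g := fun _ => (0 : ℝ)) measurableSet_Ioi, integral_zero]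
  intro t ht
  have : (φ : ℝ → ℝ) =ᶠ[𝓝 t] fun _ => 0 := by
    filter_upwards [lt_mem_nhds (mem_Ioi.1 ht)] with x hx
    exact image_eq_zero_of_notMem_tsupport fun h => (hφ h).not_gt hx
  simp only [this.iteratedDeriv_eq, iteratedDeriv_const]
  simp

theorem exists_analytic_continuation_pow (φ : RealTestFunction) : ∃ F : ℂ → ℂ,
    AnalyticOnNhd ℂ F {s | ∀ n : ℕ, s ≠ -(n : ℂ)} ∧
    (∀ s : ℂ, 0 < s.re →
      IntegrableOn (fun t : ℝ => (t : ℂ) ^ (s - 1) * (φ t : ℂ)) (Ioi 0) ∧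
      F s = ∫ t in Ioi (0 : ℝ), (t : ℂ) ^ (s - 1) * (φ t : ℂ)) ∧
    ∀ β : ℝ, (∀ n : ℕ, β ≠ -(n : ℝ)) → F β = ((powDistribution β φ : ℝ) : ℂ) := by
  refine ⟨fun s => Complex.Gamma s * entireMellin φ s, fun s hs => (analyticAt_Gamma hs).mul
    ((differentiable_entireMellin φ.contDiff φ.hasCompactSupport).analyticAt s),
    fun s hs => ⟨?_, ?_⟩, fun β h0 => (powDistribution_apply h0 φ).symm⟩
  · exact mellinConvergent_of_hasCompactSupport (Complex.continuous_ofReal.comp φ.continuous)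
      φ.hasCompactSupport.comp_ofReal hs
  · exact entireMellin_of_re_pos φ.contDiff φ.hasCompactSupport hs

/-! ### The Beta integral and continuation in two exponents. -/

theorem betaIntegral_ne_zero {a b : ℂ} (ha : 0 < a.re) (hb : 0 < b.re) :
    Complex.betaIntegral a b ≠ 0 := fun h => by
  have := Complex.Gamma_mul_Gamma_eq_betaIntegral ha hb
  rw [h, mul_zero] at this
  exact mul_ne_zero (Complex.Gamma_ne_zero_of_re_pos ha) (Complex.Gamma_ne_zero_of_re_pos hb) this

/-- A non-integrable function has integral `0` by convention, whereas the scaling identity gives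
`t^(a+b-1) B(a,b) ≠ 0`. -/
theorem intervalIntegrable_beta {a b : ℂ} (ha : 0 < a.re) (hb : 0 < b.re) {t : ℝ} (ht : 0 < t) :
    IntervalIntegrable (fun τ : ℝ => (τ : ℂ) ^ (a - 1) * ((t - τ : ℝ) : ℂ) ^ (b - 1))
      volume 0 t := by
  by_contra h
  have h1 := Complex.betaIntegral_scaled a b ht
  simp only [← Complex.ofReal_sub] at h1
  rw [intervalIntegral.integral_undef h] at h1
  refine mul_ne_zero ?_ (betaIntegral_ne_zero ha hb) h1.symm
  simp [Complex.cpow_eq_zero_iff, ht.ne']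

theorem Gamma_mul_Gamma_neg {α : ℝ} (hα : ∀ n : ℤ, α ≠ n) :
    Real.Gamma α * Real.Gamma (-α) = -(Real.pi / (α * Real.sin (Real.pi * α))) := by
  have h0 : α ≠ 0 := by simpa using hα 0
  have h := Real.Gamma_mul_Gamma_one_sub α
  rw [show 1 - α = -α + 1 by ring, Real.Gamma_add_one (neg_ne_zero.2 h0)] at h
  rw [mul_comm α, ← div_div, ← h]
  field_simp

theorem exists_analytic_continuation_beta {α : ℝ} (hα : ∀ n : ℤ, α ≠ n) (φ : RealTestFunction) :
    ∃ G : ℂ × ℂ → ℂ,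
      AnalyticOnNhd ℂ G {p | ∀ n : ℕ, p.1 ≠ -(n : ℂ) ∧ p.2 ≠ -(n : ℂ)} ∧
      (∀ a b : ℂ, 0 < a.re → 0 < b.re →
        (∀ t : ℝ, 0 < t → IntervalIntegrable
          (fun τ : ℝ => (τ : ℂ) ^ (a - 1) * ((t - τ : ℝ) : ℂ) ^ (b - 1)) volume 0 t) ∧
        IntegrableOn (fun t : ℝ =>
          (∫ τ in (0 : ℝ)..t, (τ : ℂ) ^ (a - 1) * ((t - τ : ℝ) : ℂ) ^ (b - 1)) * (φ t : ℂ))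
          (Ioi 0) ∧
        G (a, b) = ∫ t in Ioi (0 : ℝ),
          (∫ τ in (0 : ℝ)..t, (τ : ℂ) ^ (a - 1) * ((t - τ : ℝ) : ℂ) ^ (b - 1)) * (φ t : ℂ)) ∧
      G (α, -α) = ((-(Real.pi / (α * Real.sin (Real.pi * α))) * φ 0 : ℝ) : ℂ) := by
  -- Since `B(a,b) = Γ(a) Γ(b) / Γ(a+b)`, the poles of the Mellin transform at `a + b = 0, -1, …`
  -- are already divided out, so `G` is analytic there too.
  refine ⟨fun p => Complex.Gamma p.1 * Complex.Gamma p.2 * entireMellin φ (p.1 + p.2),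
    fun p hp => ?_, fun a b ha hb => ?_, ?_⟩
  · refine AnalyticAt.mul (AnalyticAt.mul ?_ ?_) ?_
    · exact (analyticAt_Gamma fun n => (hp n).1).comp analyticAt_fst
    · exact (analyticAt_Gamma fun n => (hp n).2).comp analyticAt_snd
    · exact ((differentiable_entireMellin φ.contDiff φ.hasCompactSupport).analyticAt
        (p.1 + p.2)).comp (f := fun p : ℂ × ℂ => p.1 + p.2) (analyticAt_fst.add analyticAt_snd)
  · have hab : 0 < (a + b).re := by simpa using add_pos ha hb
    have e : EqOn (fun t : ℝ =>
        (∫ τ in (0 : ℝ)..t, (τ : ℂ) ^ (a - 1) * ((t - τ : ℝ) : ℂ) ^ (b - 1)) * (φ t : ℂ))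
        (fun t : ℝ => Complex.betaIntegral a b * ((t : ℂ) ^ (a + b - 1) • (φ t : ℂ)))
        (Ioi 0) := fun t ht => by
      have h1 := Complex.betaIntegral_scaled a b (mem_Ioi.1 ht)
      simp only [← Complex.ofReal_sub] at h1
      simp only [h1, smul_eq_mul]
      ring
    have hc := mellinConvergent_of_hasCompactSupport
      (Complex.continuous_ofReal.comp φ.continuous) φ.hasCompactSupport.comp_ofReal hab
    refine ⟨fun t ht => intervalIntegrable_beta ha hb ht, ?_, ?_⟩
    · exact IntegrableOn.congr_fun (Integrable.const_mul hc _) e.symm measurableSet_Ioi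
    · rw [setIntegral_congr_fun measurableSet_Ioi e, integral_const_mul]
      change Complex.Gamma a * Complex.Gamma b * entireMellin φ (a + b) =
        _ * mellin (fun t => (φ t : ℂ)) (a + b)
      rw [← entireMellin_of_re_pos φ.contDiff φ.hasCompactSupport hab,
        Complex.Gamma_mul_Gamma_eq_betaIntegral ha hb]
      ring
  · simp only [add_neg_cancel]
    rw [entireMellin_zero φ.contDiff φ.hasCompactSupport, ← Complex.ofReal_neg,
      Complex.Gamma_ofReal, Complex.Gamma_ofReal, ← Gamma_mul_Gamma_neg hα]
    push_cast
    ring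

/-! ### The inner pairing as a function of the translation. -/

/-- `x ↦ ∫_0^∞ t ^ (q - 1) h(x + t) dt`. -/
noncomputable def translatedMoment (q : ℝ) (h : ℝ → ℝ) (x : ℝ) : ℝ :=
  ∫ t in Ioi (0 : ℝ), t ^ (q - 1) * h (x + t)

/-- As a convolution with the reflected power, this inherits smoothness from `h`, and derivatives
fall on `h`. -/
theorem translatedMoment_eq_convolution (q : ℝ) (h : ℝ → ℝ) :
    translatedMoment q h =
      convolution (fun t => powFun q (-t)) h (ContinuousLinearMap.mul ℝ ℝ) volume := by
  ext x
  rw [translatedMoment, ← integral_powFun_mul q (fun t => h (x + t)), convolution,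
    ← integral_neg_eq_self]
  simp [sub_eq_add_neg]

theorem locallyIntegrable_powFun_neg {q : ℝ} (hq : 0 < q) :
    LocallyIntegrable fun t => powFun q (-t) := by
  intro x
  obtain ⟨s, hs, h⟩ := locallyIntegrable_powFun hq (-x)
  refine ⟨Neg.neg ⁻¹' s, continuous_neg.continuousAt.preimage_mem_nhds hs, ?_⟩
  exact ((Measure.measurePreserving_neg volume).integrableOn_comp_preimage
    (Homeomorph.neg ℝ).measurableEmbedding).2 h

theorem contDiff_translatedMoment {q : ℝ} (hq : 0 < q) {h : ℝ → ℝ} (hh : ContDiff ℝ ∞ h)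
    (hc : HasCompactSupport h) : ContDiff ℝ ∞ (translatedMoment q h) := by
  rw [translatedMoment_eq_convolution]
  exact hc.contDiff_convolution_right _ (locallyIntegrable_powFun_neg hq) hh

theorem deriv_translatedMoment {q : ℝ} (hq : 0 < q) {h : ℝ → ℝ} (hh : ContDiff ℝ ∞ h)
    (hc : HasCompactSupport h) :
    deriv (translatedMoment q h) = translatedMoment q (deriv h) := by
  ext x
  rw [translatedMoment_eq_convolution, translatedMoment_eq_convolution]
  exact (hc.hasDerivAt_convolution_right _ (locallyIntegrable_powFun_neg hq)
    (hh.of_le (by simp)) x).deriv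

theorem iteratedDeriv_translatedMoment {q : ℝ} (hq : 0 < q) {h : ℝ → ℝ} (hh : ContDiff ℝ ∞ h)
    (hc : HasCompactSupport h) (m : ℕ) :
    iteratedDeriv m (translatedMoment q h) = translatedMoment q (iteratedDeriv m h) := by
  induction m with
  | zero => simp
  | succ m ih =>
    rw [iteratedDeriv_succ, ih, deriv_translatedMoment hq (contDiff_iteratedDeriv hh m)
      (hc.iteratedDeriv m), iteratedDeriv_succ]

theorem integrableOn_beta {p q : ℝ} (hp : 0 < p) (hq : 0 < q) {t : ℝ} (ht : 0 < t) :
    IntegrableOn (fun x => x ^ (p - 1) * (t - x) ^ (q - 1)) (Ioc 0 t) ∧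
    ∫ x in Ioc 0 t, x ^ (p - 1) * (t - x) ^ (q - 1) =
      Real.Gamma p * Real.Gamma q * (Real.Gamma (p + q))⁻¹ * t ^ (p + q - 1) := by
  have hp' : 0 < (p : ℂ).re := hp
  have hq' : 0 < (q : ℂ).re := hq
  have e : EqOn (fun x : ℝ => (x : ℂ) ^ ((p : ℂ) - 1) * ((t - x : ℝ) : ℂ) ^ ((q : ℂ) - 1))
      (fun x => ((x ^ (p - 1) * (t - x) ^ (q - 1) : ℝ) : ℂ)) (Ioc 0 t) := fun x hx => by
    simp only []
    rw [Complex.ofReal_mul, Complex.ofReal_cpow hx.1.le, Complex.ofReal_cpow (sub_nonneg.2 hx.2)]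
    push_cast
    rfl
  have h := (intervalIntegrable_beta hp' hq' ht).1.congr_fun e measurableSet_Ioc
  have h1 := Complex.betaIntegral_scaled p q ht
  simp only [← Complex.ofReal_sub] at h1
  rw [intervalIntegral.integral_of_le ht.le, setIntegral_congr_fun measurableSet_Ioc e,
    integral_complex_ofReal, Complex.betaIntegral_eq_Gamma_mul_div _ _ hp' hq'] at h1
  refine ⟨h.re, ?_⟩
  rw [← Complex.ofReal_inj, h1]
  rw [← Complex.ofReal_add, Complex.Gamma_ofReal, Complex.Gamma_ofReal, Complex.Gamma_ofReal]
  push_cast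
  rw [Complex.ofReal_cpow ht.le]
  push_cast
  ring

/-- The moments of `translatedMoment` are the moments of the convolution of powers. -/
theorem integral_mul_translatedMoment {p q : ℝ} (hp : 0 < p) (hq : 0 < q) {h : ℝ → ℝ}
    (hh : Continuous h) (hc : HasCompactSupport h) :
    ∫ x in Ioi (0 : ℝ), x ^ (p - 1) * translatedMoment q h x =
      Real.Gamma p * Real.Gamma q * (Real.Gamma (p + q))⁻¹ *
        ∫ t in Ioi (0 : ℝ), t ^ (p + q - 1) * h t := by
  -- The integrand after substituting `t - x` for the inner variable. For `t > 0` the two indicators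
  -- confine `x` to `Ioc 0 t`, and for `t ≤ 0` they exclude every `x`.
  set k : ℝ → ℝ → ℝ := fun x t =>
    (Ioi (0 : ℝ)).indicator (fun x => x ^ (p - 1)) x *
      ((Ici (0 : ℝ)).indicator (fun y => y ^ (q - 1)) (t - x) * h t) with hk
  have hkm : Measurable (Function.uncurry k) := by
    have m1 : Measurable ((Ioi (0 : ℝ)).indicator fun x : ℝ => x ^ (p - 1)) :=
      (measurable_id.pow_const _).indicator measurableSet_Ioi
    have m2 : Measurable ((Ici (0 : ℝ)).indicator fun x : ℝ => x ^ (q - 1)) :=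
      (measurable_id.pow_const _).indicator measurableSet_Ici
    exact (m1.comp measurable_fst).mul
      ((m2.comp (measurable_snd.sub measurable_fst)).mul (hh.measurable.comp measurable_snd))
  have kpos : ∀ t, 0 < t → (fun x => k x t) =
      (Ioc 0 t).indicator fun x => x ^ (p - 1) * (t - x) ^ (q - 1) * h t := by
    intro t ht
    ext x
    by_cases h1 : 0 < x <;> by_cases h2 : x ≤ t <;> simp [hk, indicator, h1, h2, mul_assoc]
  have kneg : ∀ t, t ≤ 0 → (fun x => k x t) = fun _ => 0 := by
    intro t ht
    ext x
    by_cases h1 : 0 < x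
    · have : ¬ x ≤ t := by linarith
      simp [hk, indicator, this]
    · simp [hk, indicator, h1]
  have kint : ∀ t, 0 < t → Integrable fun x => k x t := by
    intro t ht
    rw [kpos t ht, integrable_indicator_iff measurableSet_Ioc]
    exact (integrableOn_beta hp hq ht).1.mul_const _
  set B := Real.Gamma p * Real.Gamma q * (Real.Gamma (p + q))⁻¹
  have kval : ∀ t, 0 < t → ∫ x, k x t = B * (t ^ (p + q - 1) * h t) := by
    intro t ht
    rw [kpos t ht, integral_indicator measurableSet_Ioc, integral_mul_const,
      (integrableOn_beta hp hq ht).2]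
    ring
  have knorm : ∀ t, 0 < t → ∫ x, ‖k x t‖ = B * (t ^ (p + q - 1) * |h t|) := by
    intro t ht
    have : (fun x => ‖k x t‖) =
        (Ioc 0 t).indicator fun x => x ^ (p - 1) * (t - x) ^ (q - 1) * |h t| := by
      ext x
      have := congrFun (kpos t ht) x
      rw [this, norm_indicator_eq_indicator_norm]
      refine congrFun (indicator_congr fun y hy => ?_) x
      rw [norm_mul, norm_mul, Real.norm_eq_abs, Real.norm_eq_abs, Real.norm_eq_abs,
        abs_of_nonneg (Real.rpow_nonneg hy.1.le _),
        abs_of_nonneg (Real.rpow_nonneg (sub_nonneg.2 hy.2) _)]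
    rw [this, integral_indicator measurableSet_Ioc, integral_mul_const,
      (integrableOn_beta hp hq ht).2]
    ring
  have hint : Integrable (Function.uncurry k) (volume.prod volume) := by
    -- Integrating `‖k‖` over `x` first gives `B t^(p+q-1) |h t|`, which is integrable because `p +
    -- q > 0`.
    rw [integrable_prod_iff' hkm.aestronglyMeasurable]
    constructor
    · refine Eventually.of_forall fun t => ?_
      rcases le_or_gt t 0 with ht | ht
      · simp only [Function.uncurry_apply_pair, kneg t ht]
        exact integrable_zero _ _ _
      · exact kint t ht
    · have h1 : IntegrableOn (fun t => B * (t ^ (p + q - 1) * |h t|)) (Ioi 0) :=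
        (integrableOn_rpow_mul hh.abs hc.abs (add_pos hp hq)).const_mul B
      rw [← integrable_indicator_iff measurableSet_Ioi] at h1
      refine h1.congr (Eventually.of_forall fun t => ?_)
      rcases le_or_gt t 0 with ht | ht
      · have : ∀ x, k x t = 0 := fun x => congrFun (kneg t ht) x
        simp [this, indicator, not_lt.2 ht]
      · simp only [Function.uncurry_apply_pair, knorm t ht]
        simp [indicator, ht]
  have hswap := integral_integral_swap hint
  have hl : ∀ x, ∫ t, k x t =
      (Ioi (0 : ℝ)).indicator (fun x => x ^ (p - 1) * translatedMoment q h x) x := by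
    intro x
    by_cases hx : 0 < x
    · simp only [hk, integral_const_mul, indicator, mem_Ioi, hx, if_true]
      rw [translatedMoment, ← integral_Ici_eq_integral_Ioi, ← integral_indicator measurableSet_Ici,
        ← integral_add_left_eq_self _ x]
      congr 1
      refine integral_congr_ae (Eventually.of_forall fun t => ?_)
      by_cases ht : 0 ≤ t <;> simp [indicator, ht]
    · simp [hk, indicator, hx]
  have hr : ∀ t, ∫ x, k x t =
      (Ioi (0 : ℝ)).indicator (fun t => B * (t ^ (p + q - 1) * h t)) t := by
    intro t
    rcases le_or_gt t 0 with ht | ht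
    · simp [kneg t ht, indicator, not_lt.2 ht]
    · rw [kval t ht]; simp [indicator, ht]
  simp only [hl, hr] at hswap
  rw [integral_indicator measurableSet_Ioi, integral_indicator measurableSet_Ioi,
    integral_const_mul] at hswap
  exact hswap

/-! ### The convolution of `f_α` and `f_{-α}`. -/

/-- The left side is `regularizedMellin n g 0`, which is `entireMellin g 0` for every `n > 0`. -/
theorem moment_iteratedDeriv {g : ℝ → ℝ} (hg : ContDiff ℝ ∞ g) (hc : HasCompactSupport g)
    {n : ℕ} (hn : 0 < n) :
    (-1) ^ n * ((∫ t in Ioi (0 : ℝ), t ^ ((n : ℝ) - 1) * iteratedDeriv n g t) *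
      (Real.Gamma n)⁻¹) = g 0 := by
  have h := entireMellin_zero hg hc
  rw [entireMellin_eq (n := n) hg hc (by simpa using hn), ← Complex.ofReal_zero,
    regularizedMellin_ofReal, Complex.ofReal_inj] at h
  simpa using h

theorem HalfLineCutoff.eventuallyEq_one (η : HalfLineCutoff) {t : ℝ} (ht : 0 ≤ t) :
    η.toFun =ᶠ[𝓝 t] fun _ => 1 := by
  obtain ⟨ε, hε, h⟩ := η.eq_one
  filter_upwards [lt_mem_nhds (show -ε < t by linarith)] with x hx using h x hx.le

/-- The integral sees only `t > 0`, where `η` is locally `1` and so drops out of every derivative;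
hence the independence of the cutoff. -/
theorem powDistributionAux_cutTranslate (n : ℕ) {β : ℝ} (h0 : ∀ k : ℕ, β ≠ -(k : ℝ))
    (hn : 0 < β + n) (η : HalfLineCutoff) (φ : RealTestFunction) (x : ℝ) :
    powDistributionAux n β (cutTranslate η φ x) =
      (-1) ^ n * (Real.Gamma β * (Real.Gamma (β + n))⁻¹) *
        translatedMoment (β + n) (iteratedDeriv n φ) x := by
  rw [powDistributionAux_apply n h0 hn, translatedMoment]
  congr 1
  refine setIntegral_congr_fun measurableSet_Ioi fun t ht => ?_
  have : (cutTranslate η φ x : ℝ → ℝ) =ᶠ[𝓝 t] fun y => φ (x + y) := by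
    filter_upwards [η.eventuallyEq_one (le_of_lt ht)] with y hy
    change η.toFun y * φ (x + y) = _
    rw [hy, one_mul]
  simp only [this.iteratedDeriv_eq, iteratedDeriv_comp_const_add]

/-- A smooth function that vanishes on a right half-line, cut off on the left. -/
noncomputable def HalfLineCutoff.mulTestFunction (η : HalfLineCutoff) (K : ℝ → ℝ)
    (hK : ContDiff ℝ ∞ K) (hR : ∃ R : ℝ, ∀ t, R < t → K t = 0) : RealTestFunction where
  toFun x := η.toFun x * K x
  contDiff' := η.smooth.mul hK
  hasCompactSupport' := by
    obtain ⟨R, hR⟩ := hR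
    obtain ⟨a, ha⟩ := η.eq_zero
    refine HasCompactSupport.intro (isCompact_Icc (a := a) (b := R)) fun x hx => ?_
    rcases le_or_gt x a with h | h
    · rw [ha x h, zero_mul]
    · rw [hR x (lt_of_not_ge fun h' => hx ⟨h.le, h'⟩), mul_zero]
  tsupport_subset' := by simp

theorem exists_forall_gt_translatedMoment_eq_zero (q : ℝ) {h : ℝ → ℝ}
    (hc : HasCompactSupport h) : ∃ R : ℝ, ∀ x, R < x → translatedMoment q h x = 0 := by
  obtain ⟨R, hR⟩ := hc.exists_forall_gt_eq_zero
  refine ⟨R, fun x hx => ?_⟩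
  rw [translatedMoment, setIntegral_congr_fun (g := fun _ => (0 : ℝ)) measurableSet_Ioi,
    integral_zero]
  intro t ht
  simp only [hR (x + t) (by linarith [mem_Ioi.1 ht]), mul_zero]

theorem isConvolution_powDistribution_neg {α : ℝ} (hα : ∀ n : ℤ, α ≠ n) :
    IsConvolution (powDistribution α) (powDistribution (-α))
      ((-(Real.pi / (α * Real.sin (Real.pi * α)))) •
        (Distribution.delta 0 : RealDistribution)) := by
  have ha : ∀ k : ℕ, α ≠ -(k : ℝ) := fun k h => hα (-k) (by push_cast; exact h)
  have hb : ∀ k : ℕ, -α ≠ -(k : ℝ) := fun k h => hα k (by push_cast; linarith)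
  refine ⟨isVanishingOn_powDistribution ha, isVanishingOn_powDistribution hb, fun η φ => ?_⟩
  have hm := add_floor_pos α ha
  have hn := add_floor_pos (-α) hb
  rw [powDistribution, powDistribution]
  set m := ⌊1 - α⌋₊
  set n := ⌊1 - -α⌋₊
  have hφn := contDiff_iteratedDeriv φ.contDiff n
  have hcn := φ.hasCompactSupport.iteratedDeriv n
  set C := (-1) ^ n * (Real.Gamma (-α) * (Real.Gamma (-α + n))⁻¹) with hC
  set K := translatedMoment (-α + n) (iteratedDeriv n φ) with hKdef
  have hK : ContDiff ℝ ∞ K := contDiff_translatedMoment hn hφn hcn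
  obtain ⟨R, hR⟩ := exists_forall_gt_translatedMoment_eq_zero (-α + n) hcn
  -- `C * K x` is the inner pairing at `x`. It vanishes for large `x` but not necessarily near `-∞`,
  -- where `η` provides the cutoff.
  set ψ : RealTestFunction := η.mulTestFunction (fun x => C * K x) (contDiff_const.mul hK)
    ⟨R, fun t ht => by rw [hKdef, hR t ht, mul_zero]⟩
  refine ⟨ψ, fun x => ?_, ?_⟩
  · rw [powDistributionAux_cutTranslate n hb hn]
    rfl
  have hmom : ∫ t in Ioi (0 : ℝ), t ^ (α + m - 1) * iteratedDeriv m ψ t =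
      C * ∫ t in Ioi (0 : ℝ), t ^ (α + m - 1) *
        translatedMoment (-α + n) (iteratedDeriv (m + n) φ) t := by
    rw [← integral_const_mul]
    refine setIntegral_congr_fun measurableSet_Ioi fun t ht => ?_
    have : (ψ : ℝ → ℝ) =ᶠ[𝓝 t] fun y => C * K y := by
      filter_upwards [η.eventuallyEq_one (le_of_lt ht)] with y hy
      change η.toFun y * (C * K y) = _
      rw [hy, one_mul]
    simp only [this.iteratedDeriv_eq, iteratedDeriv_const_mul_field, hKdef,
      iteratedDeriv_translatedMoment hn hφn hcn]
    rw [show iteratedDeriv m (iteratedDeriv n φ) = iteratedDeriv (m + n) φ by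
      simp only [iteratedDeriv_eq_iterate, Function.iterate_add_apply]]
    ring
  have hsum : α + m + (-α + n) = ((m + n : ℕ) : ℝ) := by push_cast; ring
  -- The exponents `±α` cancel, so the Beta integral leaves the integer exponent `m + n`, positive
  -- as a sum of two positive numbers.
  have hpos : 0 < m + n := by
    have : (0 : ℝ) < ((m + n : ℕ) : ℝ) := by rw [← hsum]; exact add_pos hm hn
    exact_mod_cast this
  have h0 := moment_iteratedDeriv φ.contDiff φ.hasCompactSupport hpos
  rw [powDistributionAux_apply m ha hm, hmom,
    integral_mul_translatedMoment hm hn (continuous_iteratedDeriv φ.contDiff _)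
      (φ.hasCompactSupport.iteratedDeriv _), hsum]
  change -(Real.pi / (α * Real.sin (Real.pi * α))) * φ 0 = _
  -- The factors `Γ(α+m)` and `Γ(-α+n)` of the Beta integral cancel the inverses from the two
  -- pairings, leaving `Γ(α) Γ(-α)`.
  rw [← h0, ← Gamma_mul_Gamma_neg hα, hC, pow_add]
  have g1 := (Real.Gamma_pos_of_pos hm).ne'
  have g2 := (Real.Gamma_pos_of_pos hn).ne'
  field_simp

theorem mainTheorem3 (α : ℝ) (hα : ∀ n : ℤ, α ≠ n) :
    -- the distributions `f_β` are the analytic continuation in the exponent of `t₊^(β-1)`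
    (∀ φ : RealTestFunction, ∃ F : ℂ → ℂ,
      AnalyticOnNhd ℂ F {s | ∀ n : ℕ, s ≠ -(n : ℂ)} ∧
      (∀ s : ℂ, 0 < s.re →
        IntegrableOn (fun t : ℝ => (t : ℂ) ^ (s - 1) * (φ t : ℂ)) (Set.Ioi 0) ∧
        F s = ∫ t in Set.Ioi (0 : ℝ), (t : ℂ) ^ (s - 1) * (φ t : ℂ)) ∧
      ∀ β : ℝ, (∀ n : ℕ, β ≠ -(n : ℝ)) → F β = ((powDistribution β φ : ℝ) : ℂ)) ∧
    -- the convolution of the distributions `f_α` and `f_{-α}`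
    IsConvolution (powDistribution α) (powDistribution (-α))
      ((-(Real.pi / (α * Real.sin (Real.pi * α)))) • (Distribution.delta 0 : RealDistribution)) ∧
    -- the convolution integral, continued analytically in the two exponents
    (∀ φ : RealTestFunction, ∃ G : ℂ × ℂ → ℂ,
      AnalyticOnNhd ℂ G {p | ∀ n : ℕ, p.1 ≠ -(n : ℂ) ∧ p.2 ≠ -(n : ℂ)} ∧
      (∀ a b : ℂ, 0 < a.re → 0 < b.re →
        (∀ t : ℝ, 0 < t → IntervalIntegrable
          (fun τ : ℝ => (τ : ℂ) ^ (a - 1) * ((t - τ : ℝ) : ℂ) ^ (b - 1)) volume 0 t) ∧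
        IntegrableOn (fun t : ℝ =>
          (∫ τ in (0 : ℝ)..t, (τ : ℂ) ^ (a - 1) * ((t - τ : ℝ) : ℂ) ^ (b - 1)) * (φ t : ℂ))
          (Set.Ioi 0) ∧
        G (a, b) = ∫ t in Set.Ioi (0 : ℝ),
          (∫ τ in (0 : ℝ)..t, (τ : ℂ) ^ (a - 1) * ((t - τ : ℝ) : ℂ) ^ (b - 1)) * (φ t : ℂ)) ∧
      G (α, -α) = ((-(Real.pi / (α * Real.sin (Real.pi * α))) * φ 0 : ℝ) : ℂ)) := by
  exact ⟨exists_analytic_continuation_pow, isConvolution_powDistribution_neg hα,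
    exists_analytic_continuation_beta hα⟩
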